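/- A compact ordered space is a compact topological space $X$ equipped with a partial order $\leq$ that is a closed subset of $X \times X$. Let $\mathsf{CompOrd}$ be the category of compact ordered spaces and order-preserving continuous maps. A first-order definable class of structures is the class of all models of some first-order theory $T$ in some (arbitrary) first-order language; it is regarded as a category whose morphisms are the homomorphisms, i.e. the functions that commute with all function symbols (constants included) and preserve all relation symbols. Then $\mathsf{CompOrd}$ is not dually equivalent to any first-order definable class of structures: for every first-order language $L$ and every first-order theory $T$ in $L$, there is no equivalence of categories between $\mathsf{CompOrd}^{\mathrm{op}}$ and the category of models of $T$ and homomorphisms. (The empty structure is admitted as a model. The version with only nonempty models is a special case, since one can add the axiom $\exists y\,(y = y)$ to $T$.) -/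

import Mathlib

open CategoryTheory

universe u v x

/-- A compact ordered space: a compact topological space together with a partial order that is
closed as a subset of the product of the space with itself. -/
structure CompOrd : Type (u + 1) where
  /-- The underlying set. -/
  carrier : Type u
  [top : TopologicalSpace carrier]
  [order : PartialOrder carrier]
  [compact : CompactSpace carrier]
  [closed : OrderClosedTopology carrier]

attribute [instance] CompOrd.top CompOrd.order CompOrd.compact CompOrd.closed

/-- The category of compact ordered spaces and continuous order-preserving maps. -/
instance CompOrd.category : Category.{u} CompOrd.{u} where
  Hom X Y := X.carrier →Co Y.carrier
  id X := ContinuousOrderHom.id X.carrier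
  comp f g := g.comp f

/-- A model of a first-order theory `T`. The carrier may be empty; the classes of nonempty models
are included, as those of theories that contain the sentence `∃ y, y = y`. -/
structure FirstOrder.Language.Theory.Models {L : FirstOrder.Language.{u, v}} (T : L.Theory) :
    Type (max u v (x + 1)) where
  /-- The underlying set. -/
  carrier : Type x
  [str : L.Structure carrier]
  [model : T.Model carrier]

attribute [instance] FirstOrder.Language.Theory.Models.str
  FirstOrder.Language.Theory.Models.model

/-- The category of all models of `T`, with homomorphisms: functions that commute with all function
symbols and preserve (not necessarily reflect) all relation symbols. -/
instance FirstOrder.Language.Theory.Models.category {L : FirstOrder.Language.{u, v}}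
    (T : L.Theory) : Category.{x} (FirstOrder.Language.Theory.Models.{u, v, x} T) where
  Hom M N := L.Hom M.carrier N.carrier
  id M := FirstOrder.Language.Hom.id L M.carrier
  comp f g := g.comp f

/-! Models of `T` need not be closed under directed colimits, but the ultraproduct of a sequence of
models along a nonprincipal ultrafilter is still a cocone over it. So if a colimit exists, elements
identified there are identified in the ultraproduct, hence already at some stage. In compact ordered
spaces the dual statement fails. The diagonal of the unit square is the limit of the strips `|s - t|
≤ 1 / (n + 1)`. Given a dual equivalence, for each element `a` over `[0, 1]` the two projections
would act alike on `a` on some strip. Close points then act alike on `a`, and finitely many short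
steps lead from `0` to `1`. Faithfulness gives `0 = 1`. -/

open Filter Limits

namespace FirstOrder.Language.Theory.Models

variable {L : FirstOrder.Language.{u, v}} {T : L.Theory}

/-- The function underlying a morphism of models. -/
def apply {M N : FirstOrder.Language.Theory.Models.{u, v, x} T} (f : M ⟶ N) :
    M.carrier → N.carrier :=
  FirstOrder.Language.Hom.toFun f

theorem hom_ext {M N : FirstOrder.Language.Theory.Models.{u, v, x} T} {f g : M ⟶ N}
    (h : ∀ a, apply f a = apply g a) : f = g :=
  FirstOrder.Language.Hom.ext h

@[simp]
theorem apply_comp {M N P : FirstOrder.Language.Theory.Models.{u, v, x} T} (f : M ⟶ N)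
    (g : N ⟶ P) (a : M.carrier) : apply (f ≫ g) a = apply g (apply f a) :=
  rfl

theorem apply_map_comp {C : Type*} [Category C]
    (F : C ⥤ FirstOrder.Language.Theory.Models.{u, v, x} T) {X Y Z : C} (f : X ⟶ Y) (g : Y ⟶ Z)
    (a : (F.obj X).carrier) : apply (F.map (f ≫ g)) a = apply (F.map g) (apply (F.map f) a) := by
  rw [F.map_comp, apply_comp]

theorem apply_funMap {M N : FirstOrder.Language.Theory.Models.{u, v, x} T} (f : M ⟶ N) {n : ℕ}
    (k : L.Functions n) (a : Fin n → M.carrier) :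
    apply f (Structure.funMap k a) = Structure.funMap k fun i => apply f (a i) :=
  FirstOrder.Language.Hom.map_fun' f k a

theorem apply_relMap {M N : FirstOrder.Language.Theory.Models.{u, v, x} T} (f : M ⟶ N) {n : ℕ}
    (r : L.Relations n) (a : Fin n → M.carrier) (h : Structure.RelMap r a) :
    Structure.RelMap r fun i => apply f (a i) :=
  FirstOrder.Language.Hom.map_rel' f r a h

/-- The ultraproduct of a family of nonempty models of a theory. -/
def ultraproduct {ι : Type} (M : ι → FirstOrder.Language.Theory.Models.{u, v, x} T)
    [∀ i, Nonempty (M i).carrier] (U : Ultrafilter ι) :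
    FirstOrder.Language.Theory.Models.{u, v, x} T where
  carrier := (U : Filter ι).Product fun i => (M i).carrier
  model := ⟨fun φ hφ => (Ultraproduct.sentence_realize φ).2
    (Eventually.of_forall fun i => (M i).model.realize_of_mem φ hφ)⟩

/-! ### Ultraproducts as cocones over sequences -/

section Sequence

variable (F : ℕ ⥤ FirstOrder.Language.Theory.Models.{u, v, x} T)
  [∀ n, Nonempty (F.obj n).carrier]

open Classical in
/-- The sequence of images of an element of a directed sequence of models, with arbitrary values
at the indices before that of the element. -/
noncomputable def thread {m : ℕ} (a : (F.obj m).carrier) (n : ℕ) : (F.obj n).carrier :=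
  if h : m ≤ n then apply (F.map (homOfLE h)) a else Classical.arbitrary _

variable {F} in
theorem thread_of_le {m n : ℕ} (a : (F.obj m).carrier) (h : m ≤ n) :
    thread F a n = apply (F.map (homOfLE h)) a :=
  dif_pos h

/-- Nonprincipality makes the arbitrary early values of `thread` irrelevant. -/
theorem eventually_le_hyperfilter (m : ℕ) : ∀ᶠ n in (hyperfilter ℕ : Filter ℕ), m ≤ n :=
  Nat.hyperfilter_le_atTop (eventually_ge_atTop m)

/-- The canonical map from a member of a directed sequence of models to the ultraproduct of the
sequence. -/
noncomputable def toUltraproduct (m : ℕ) : F.obj m ⟶ ultraproduct F.obj (hyperfilter ℕ) :=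
  show L.Hom (F.obj m).carrier _ from
  { toFun := fun a => Quotient.mk ((hyperfilter ℕ : Filter ℕ).productSetoid _) (thread F a)
    map_fun' := fun k a => by
      refine Eq.trans (Quotient.sound ?_)
        (Ultraproduct.funMap_cast k fun i => thread F (a i)).symm
      filter_upwards [eventually_le_hyperfilter m] with n hn
      simp only [thread_of_le _ hn]
      exact apply_funMap _ _ _
    map_rel' := fun r a h => by
      refine (relMap_quotient_mk' (s := (hyperfilter ℕ : Filter ℕ).productSetoid _) r
        fun i => thread F (a i)).2 ?_
      change ∀ᶠ n in (hyperfilter ℕ : Filter ℕ), Structure.RelMap r fun i => thread F (a i) n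
      filter_upwards [eventually_le_hyperfilter m] with n hn
      simp only [thread_of_le _ hn]
      exact apply_relMap _ _ _ h }

theorem toUltraproduct_eq_iff {m m' : ℕ} (a : (F.obj m).carrier) (b : (F.obj m').carrier) :
    apply (toUltraproduct F m) a = apply (toUltraproduct F m') b ↔
      ∀ᶠ n in (hyperfilter ℕ : Filter ℕ), thread F a n = thread F b n :=
  Quotient.eq (r := (hyperfilter ℕ : Filter ℕ).productSetoid _)

/-- The ultraproduct of a directed sequence of models is a cocone over the sequence. -/
noncomputable def ultraproductCocone : Cocone F where
  pt := ultraproduct F.obj (hyperfilter ℕ)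
  ι :=
    { app := toUltraproduct F
      naturality := fun m m' f => hom_ext fun a => by
        refine (toUltraproduct_eq_iff F _ _).2 ?_
        filter_upwards [eventually_le_hyperfilter m'] with n hn
        rw [thread_of_le _ hn, thread_of_le _ ((leOfHom f).trans hn)]
        exact (apply_map_comp F f (homOfLE hn) a).symm }

end Sequence

/-- Elements of a directed sequence of models that become equal in the colimit become equal at
some stage. -/
theorem exists_apply_eq_of_isColimit {F : ℕ ⥤ FirstOrder.Language.Theory.Models.{u, v, x} T}
    {c : Cocone F} (hc : IsColimit c) {a b : (F.obj 0).carrier}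
    (hab : apply (c.ι.app 0) a = apply (c.ι.app 0) b) :
    ∃ n : ℕ, apply (F.map (homOfLE n.zero_le)) a = apply (F.map (homOfLE n.zero_le)) b := by
  -- The images of `a` make every stage nonempty, as the ultraproduct requires.
  have : ∀ n, Nonempty (F.obj n).carrier := fun n => ⟨apply (F.map (homOfLE n.zero_le)) a⟩
  have h : apply (toUltraproduct F 0) a = apply (toUltraproduct F 0) b := by
    have hf : c.ι.app 0 ≫ hc.desc (ultraproductCocone F) = toUltraproduct F 0 :=
      hc.fac (ultraproductCocone F) 0
    rw [← hf]
    exact congrArg (apply (hc.desc (ultraproductCocone F))) hab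
  obtain ⟨n, hn⟩ := ((toUltraproduct_eq_iff F _ _).1 h).exists
  rw [thread_of_le a n.zero_le, thread_of_le b n.zero_le] at hn
  exact ⟨n, hn⟩

end FirstOrder.Language.Theory.Models

instance ULift.orderClosedTopology {α : Type*} [TopologicalSpace α] [Preorder α]
    [OrderClosedTopology α] : OrderClosedTopology (ULift α) where
  isClosed_le' := isClosed_le (f := fun p : ULift α × ULift α => p.1.down)
    (g := fun p => p.2.down) (by fun_prop) (by fun_prop)

/-! ### The diagonal as a limit of strips -/

namespace CompOrd

/-- A small compact ordered space, lifted to an arbitrary universe. -/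
def ulift (Y : Type) [TopologicalSpace Y] [PartialOrder Y] [CompactSpace Y]
    [OrderClosedTopology Y] : CompOrd.{x} where
  carrier := ULift.{x} Y

/-- The morphism between lifted spaces that is induced by a continuous monotone map. -/
def uliftMap {Y Z : Type} [TopologicalSpace Y] [PartialOrder Y] [CompactSpace Y]
    [OrderClosedTopology Y] [TopologicalSpace Z] [PartialOrder Z] [CompactSpace Z]
    [OrderClosedTopology Z] (f : Y → Z) (hf : Continuous f) (hf' : Monotone f) :
    ulift.{x} Y ⟶ ulift.{x} Z :=
  show ULift.{x} Y →Co ULift.{x} Z from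
  { toFun := fun y => ⟨f y.down⟩
    monotone' := fun _ _ h => hf' h
    continuous_toFun := by fun_prop }

theorem hom_ext {X Y : CompOrd.{x}} {f g : X ⟶ Y}
    (h : ∀ a, f.toFun a = g.toFun a) : f = g :=
  DFunLike.ext (F := X.carrier →Co Y.carrier) f g h

/-- The pairs of points of the unit interval at distance at most `ε`. -/
abbrev Strip (ε : ℝ) : Type := {p : Set.Icc (0 : ℝ) 1 × Set.Icc (0 : ℝ) 1 // dist p.1 p.2 ≤ ε}

instance (ε : ℝ) : CompactSpace (Strip ε) :=
  isCompact_iff_compactSpace.1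
    (isClosed_le (continuous_fst.dist continuous_snd) continuous_const).isCompact

/-- The inclusion of a strip into a wider one. -/
def stripMap {ε δ : ℝ} (h : ε ≤ δ) : ulift.{x} (Strip ε) ⟶ ulift.{x} (Strip δ) :=
  uliftMap (fun p => ⟨p.1, p.2.trans h⟩) (by fun_prop) fun _ _ h => h

/-- The first projection of a strip. -/
def stripFst (ε : ℝ) : ulift.{x} (Strip ε) ⟶ ulift.{x} (Set.Icc (0 : ℝ) 1) :=
  uliftMap (fun p => p.1.1) (by fun_prop) fun _ _ h => h.1

/-- The second projection of a strip. -/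
def stripSnd (ε : ℝ) : ulift.{x} (Strip ε) ⟶ ulift.{x} (Set.Icc (0 : ℝ) 1) :=
  uliftMap (fun p => p.1.2) (by fun_prop) fun _ _ h => h.2

instance : OrderClosedTopology Unit :=
  ⟨isClosed_discrete _⟩

/-- The morphism from the one-point space that picks a given point. -/
def point {Y : Type} [TopologicalSpace Y] [PartialOrder Y] [CompactSpace Y]
    [OrderClosedTopology Y] (y : Y) : ulift.{x} Unit ⟶ ulift.{x} Y :=
  uliftMap (fun _ => y) continuous_const monotone_const

theorem inv_succ_antitone {m n : ℕ} (h : m ≤ n) : ((n : ℝ) + 1)⁻¹ ≤ ((m : ℝ) + 1)⁻¹ := by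
  gcongr

/-- The decreasing sequence of the closed neighbourhoods of the diagonal of the unit square that
consist of the pairs at distance at most `1 / (n + 1)`. -/
noncomputable def strips : ℕ ⥤ CompOrd.{x}ᵒᵖ where
  obj n := .op (ulift (Strip ((n : ℝ) + 1)⁻¹))
  map f := (stripMap (inv_succ_antitone (leOfHom f))).op
  map_id _ := rfl
  map_comp _ _ := rfl

/-- The diagonal, as a cone over the sequence of its neighbourhoods. -/
noncomputable def stripsCocone : Cocone strips.{x} where
  pt := .op (ulift (Strip 0))
  ι :=
    { app := fun n => (stripMap (by positivity)).op
      naturality := fun _ _ _ => rfl }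

/-- The component at stage 0 factors through every narrower strip. -/
theorem dist_le_zero_of_cocone (s : Cocone strips.{x}) (a : s.pt.unop.carrier) :
    dist ((s.ι.app 0).unop.toFun a).down.1.1 ((s.ι.app 0).unop.toFun a).down.1.2 ≤ 0 := by
  refine ge_of_tendsto' (x := atTop) (f := fun n : ℕ => ((n : ℝ) + 1)⁻¹) ?_ fun n => ?_
  · simpa [one_div] using tendsto_one_div_add_atTop_nhds_zero_nat (𝕜 := ℝ)
  · have h : (s.ι.app 0).unop = (s.ι.app n).unop ≫ stripMap (inv_succ_antitone n.zero_le) :=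
      congrArg Quiver.Hom.unop (s.w (homOfLE n.zero_le)).symm
    rw [h]
    exact ((s.ι.app n).unop.toFun a).down.2

/-- The diagonal is the limit of its neighbourhoods. -/
noncomputable def stripsIsColimit : IsColimit stripsCocone.{x} where
  desc s := Quiver.Hom.op
    (show s.pt.unop.carrier →Co ULift.{x} (Strip 0) from
      { toFun := fun a => ⟨⟨((s.ι.app 0).unop.toFun a).down.1, dist_le_zero_of_cocone s a⟩⟩
        monotone' := fun _ _ h => (s.ι.app 0).unop.monotone' h
        continuous_toFun := continuous_uliftUp.comp <| Continuous.subtype_mk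
          (continuous_subtype_val.comp
            (continuous_uliftDown.comp (s.ι.app 0).unop.continuous_toFun)) _ })
  fac s n := Quiver.Hom.unop_inj <| hom_ext fun a => by
    have h : (s.ι.app 0).unop = (s.ι.app n).unop ≫ stripMap (inv_succ_antitone n.zero_le) :=
      congrArg Quiver.Hom.unop (s.w (homOfLE n.zero_le)).symm
    refine ULift.ext _ _ (Subtype.ext ?_)
    change ((s.ι.app 0).unop.toFun a).down.1 = ((s.ι.app n).unop.toFun a).down.1
    rw [h]
    rfl
  uniq s m hm := Quiver.Hom.unop_inj <| hom_ext fun a => by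
    refine ULift.ext _ _ (Subtype.ext ?_)
    change _ = ((s.ι.app 0).unop.toFun a).down.1
    rw [← hm 0]
    rfl

theorem stripFst_zero : stripFst.{x} 0 = stripSnd 0 :=
  hom_ext fun a => ULift.ext _ _ (dist_le_zero.1 a.down.2)

end CompOrd

/-! ### Connectedness of the interval by short steps -/

open FirstOrder.Language.Theory.Models CompOrd

/-- For an element of the image of the unit interval under a finitary contravariant functor, the
two projections agree on some closed neighbourhood of the diagonal. -/
theorem exists_apply_stripFst_eq {L : FirstOrder.Language.{u, v}} {T : L.Theory}
    (G : CompOrd.{x}ᵒᵖ ⥤ FirstOrder.Language.Theory.Models.{u, v, x} T)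
    [PreservesColimit strips G] (a : (G.obj (.op (ulift (Set.Icc (0 : ℝ) 1)))).carrier) :
    ∃ n : ℕ, apply (G.map (stripFst ((n : ℝ) + 1)⁻¹).op) a =
      apply (G.map (stripSnd ((n : ℝ) + 1)⁻¹).op) a := by
  have hab : apply (G.map (stripsCocone.ι.app 0))
        (apply (G.map (stripFst (((0 : ℕ) : ℝ) + 1)⁻¹).op) a) =
      apply (G.map (stripsCocone.ι.app 0))
        (apply (G.map (stripSnd (((0 : ℕ) : ℝ) + 1)⁻¹).op) a) :=
    (apply_map_comp G (stripFst _).op (stripsCocone.ι.app 0) a).symm.trans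
      ((congrArg (fun f => apply (G.map (Quiver.Hom.op f)) a) stripFst_zero).trans
        (apply_map_comp G (stripSnd _).op (stripsCocone.ι.app 0) a))
  obtain ⟨n, hn⟩ := exists_apply_eq_of_isColimit (isColimitOfPreserves G stripsIsColimit) hab
  exact ⟨n, (apply_map_comp G (stripFst _).op (strips.map (homOfLE n.zero_le)) a).trans
    (hn.trans (apply_map_comp G (stripSnd _).op (strips.map (homOfLE n.zero_le)) a).symm)⟩

/-- The points of the unit interval cannot be told apart by a finitary contravariant functor to a
category of models. -/
theorem apply_point_zero_eq_one {L : FirstOrder.Language.{u, v}} {T : L.Theory}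
    (G : CompOrd.{x}ᵒᵖ ⥤ FirstOrder.Language.Theory.Models.{u, v, x} T)
    [PreservesColimit strips G] (a : (G.obj (.op (ulift (Set.Icc (0 : ℝ) 1)))).carrier) :
    apply (G.map (point (0 : Set.Icc (0 : ℝ) 1)).op) a =
      apply (G.map (point (1 : Set.Icc (0 : ℝ) 1)).op) a := by
  obtain ⟨n, hn⟩ := exists_apply_stripFst_eq G a
  have close : ∀ s t : Set.Icc (0 : ℝ) 1, dist s t ≤ ((n : ℝ) + 1)⁻¹ →
      apply (G.map (point s).op) a = apply (G.map (point t).op) a := fun s t hst => by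
    -- The projections send `p` to `s` and `t`.
    let p : Strip ((n : ℝ) + 1)⁻¹ := ⟨(s, t), hst⟩
    have h := congrArg (apply (G.map (point p).op)) hn
    exact (apply_map_comp G (stripFst _).op (point p).op a).trans
      (h.trans (apply_map_comp G (stripSnd _).op (point p).op a).symm)
  have hpos : (0 : ℝ) < n + 1 := by positivity
  have chain : ∀ k : ℕ, ∀ t : Set.Icc (0 : ℝ) 1, (t : ℝ) = k / ((n : ℝ) + 1) →
      apply (G.map (point (0 : Set.Icc (0 : ℝ) 1)).op) a = apply (G.map (point t).op) a := by
    intro k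
    induction k with
    | zero =>
      intro t ht
      have : t = 0 := Subtype.ext (by simpa using ht)
      rw [this]
    | succ k ih =>
      intro t ht
      have hk : (k : ℝ) / (n + 1) + (n + 1 : ℝ)⁻¹ = t := by
        rw [ht]
        push_cast
        ring
      have hinv : 0 < (n + 1 : ℝ)⁻¹ := by positivity
      have ht1 := t.2.2
      -- The preceding grid point is exactly one strip width below `t`.
      refine (ih ⟨(k : ℝ) / (n + 1), by positivity, by linarith⟩ rfl).trans (close _ _ ?_)
      rw [Subtype.dist_eq, Real.dist_eq, abs_le]
      constructor <;> dsimp only <;> linarith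
  exact chain (n + 1) 1 (by push_cast; rw [div_self hpos.ne'])

/-- The category of compact ordered spaces is not dually equivalent to the category of models
and homomorphisms of any first-order theory, in any first-order language. -/
theorem mainTheorem4 (L : FirstOrder.Language.{u, v}) (T : L.Theory) :
    ¬ Nonempty (CompOrd.{x}ᵒᵖ ≌ FirstOrder.Language.Theory.Models.{u, v, x} T) := by
  rintro ⟨e⟩
  have h : (point.{x} (0 : Set.Icc (0 : ℝ) 1)).op = (point (1 : Set.Icc (0 : ℝ) 1)).op :=
    -- Only faithfulness and preservation of this one colimit are used.
    e.functor.map_injective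
      (FirstOrder.Language.Theory.Models.hom_ext (apply_point_zero_eq_one e.functor))
  have h' := congrArg (fun f => (f.unop.toFun ⟨()⟩ : ULift (Set.Icc (0 : ℝ) 1)).down) h
  exact zero_ne_one h'
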